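/- Let $g\ge 3$. A canonical polygon is a convex polygon $P$ in the hyperbolic plane with $4g$ geodesic sides $a_1,\dots,a_{4g}$, ordered clockwise, and interior angles $\alpha_i$ between $a_i$ and $a_{i+1}$ (indices modulo $4g$), such that (i) $a_i$ and $a_{i+2g}$ have the same length for all $i$; (ii) $\sum_{i=1}^{4g}\alpha_i=2\pi$; (iii) $0<\alpha_i<\pi$ for all $i$; (iv) $\alpha_1=\alpha_{2g+1}$; (v) $\sum_{i=1}^{g}\alpha_{2i-1}+\sum_{i=g+1}^{2g}\alpha_{2i}=\sum_{i=1}^{g}\alpha_{2i}+\sum_{i=g+1}^{2g}\alpha_{2i-1}$. Two canonical polygons are equivalent if an isometry of the hyperbolic plane maps the side $a_i$ of the first to the side $a_i$ of the second for every $i$. The Teichmüller space $\mathcal T_g$ is the set of equivalence classes, with the topology in which convergence means convergence of all side lengths and all interior angles. Let $Q_i$ be the common vertex of $a_i$ and $a_{i+1}$. For $1\le i\le 2g-1$ let $\beta_i$ be the angle $\angle Q_iQ_{4g}Q_{i+1}$ at $Q_{4g}$, and let $\phi_1$ be the angle $\angle Q_{4g}Q_2Q_1$ at $Q_2$. Put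 $\theta_i=\alpha_i$ for $1\le i\le 4g-4$, $i\ne 2g+1$; $\theta_{2g+1}=\phi_1$; and $\theta_{4g-4+i}=\beta_i$ for $1\le i\le 2g-1$. Theorem. The $6g-5$ angles $\theta=(\theta_1,\dots,\theta_{6g-5})$ parametrize $\mathcal T_g$: they depend only on the equivalence class of the polygon, they determine this class uniquely, and the resulting map $\Theta:\mathcal T_g\to\mathbb R^{6g-5}$ is a topological embedding, that is, a homeomorphism onto its image. -/

import Mathlib

open UpperHalfPlane

noncomputable section

/-- The Cayley-type transformation `w ↦ (w - z) / (w - conj z)`. It is holomorphic, maps the upper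
half-plane `ℍ` onto the unit disc and sends `z` to the centre `0`, so it is conformal, preserves
orientation, and turns the geodesic segment from `z` to `w` into a straight segment issuing
from `0`. Hence `hypDir z w` points in the direction in which the geodesic segment from `z` to `w`
leaves `z`. -/
def hypDir (z w : ℍ) : ℂ :=
  ((w : ℂ) - (z : ℂ)) / ((w : ℂ) - (starRingEnd ℂ) (z : ℂ))

/-- The hyperbolic angle, in `[0, π]`, at the point `z` between the geodesic segments from `z` to `x`
and from `z` to `y`. -/
def hypAngle (z x y : ℍ) : ℝ :=
  InnerProductGeometry.angle (hypDir z x) (hypDir z y)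

/-- The point `z` lies strictly to the right of the oriented geodesic line from `x` through `y`
(in particular `x ≠ y`). -/
def IsRightOf (x y z : ℍ) : Prop :=
  (hypDir x z / hypDir x y).im < 0

/-- The geodesic segment in `ℍ` with end points `x` and `y`. -/
def hypSegment (x y : ℍ) : Set ℍ :=
  {z | dist x z + dist z y = dist x y}

/-- For a closed polygon with vertices `Q i`, indexed modulo `n`, the length of its side from
`Q (i - 1)` to `Q i`. -/
def polygonSideLength {n : ℕ} (Q : ZMod n → ℍ) (i : ZMod n) : ℝ :=
  dist (Q (i - 1)) (Q i)

/-- For a convex closed polygon with vertices `Q i`, indexed modulo `n`, its interior angle at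
`Q i`. -/
def polygonAngle {n : ℕ} (Q : ZMod n → ℍ) (i : ZMod n) : ℝ :=
  hypAngle (Q i) (Q (i - 1)) (Q (i + 1))

/-- A canonical polygon with `4 g` sides in the hyperbolic plane, given by its vertices
`Q_1, …, Q_{4g}` with indices modulo `4 g`. The side `a_i` is the segment from `Q_{i-1}` to `Q_i`,
so that `Q_i` is the common vertex of `a_i` and `a_{i+1}`, and `α_i` is the interior angle there.
A hyperbolic polygon all of whose interior angles are less than `π` is the same as a convex polygon,
the intersection of the half-planes bounded by its sides; this is what the field `convex` says. -/
structure CanonicalPolygon (g : ℕ) where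
  /-- The vertices `Q_i`. -/
  vertex : ZMod (4 * g) → ℍ
  /-- The vertices bound a convex polygon with exactly `4 g` vertices, ordered clockwise: for each
  side, all vertices not on that side lie strictly to its right. -/
  convex : ∀ i j, j ≠ i - 1 → j ≠ i → IsRightOf (vertex (i - 1)) (vertex i) (vertex j)
  /-- (i) Opposite sides `a_i` and `a_{i+2g}` have the same length. -/
  opposite_sides : ∀ i, polygonSideLength vertex i = polygonSideLength vertex (i + 2 * g)
  /-- (ii) The sum of the interior angles is `2 π`. -/
  angle_sum : ∑ i ∈ Finset.Icc (1 : ℕ) (4 * g), polygonAngle vertex i = 2 * Real.pi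
  /-- (iii) The interior angles lie strictly between `0` and `π`. -/
  angle_mem : ∀ i, 0 < polygonAngle vertex i ∧ polygonAngle vertex i < Real.pi
  /-- (iv) `α_1 = α_{2g+1}`. -/
  angle_one : polygonAngle vertex 1 = polygonAngle vertex (2 * g + 1)
  /-- (v) The alternating condition on the interior angles. -/
  angle_alternating :
    ∑ i ∈ Finset.Icc (1 : ℕ) g, polygonAngle vertex (2 * i - 1) +
      ∑ i ∈ Finset.Icc (g + 1 : ℕ) (2 * g), polygonAngle vertex (2 * i) =
    ∑ i ∈ Finset.Icc (1 : ℕ) g, polygonAngle vertex (2 * i) +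
      ∑ i ∈ Finset.Icc (g + 1 : ℕ) (2 * g), polygonAngle vertex (2 * i - 1)

namespace CanonicalPolygon

variable {g : ℕ}

/-- The side `a_i`. -/
def side (P : CanonicalPolygon g) (i : ZMod (4 * g)) : Set ℍ :=
  hypSegment (P.vertex (i - 1)) (P.vertex i)

/-- The length of the side `a_i`. -/
def sideLength (P : CanonicalPolygon g) (i : ZMod (4 * g)) : ℝ :=
  polygonSideLength P.vertex i

/-- The interior angle `α_i` between the sides `a_i` and `a_{i+1}`. -/
def angle (P : CanonicalPolygon g) (i : ZMod (4 * g)) : ℝ :=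
  polygonAngle P.vertex i

/-- The angle `β_i` at `Q_{4g}` between the segments from `Q_{4g}` to `Q_i` and to `Q_{i+1}`. For
`i = 1` these are the side `a_1` and the diagonal `b_1`, for larger `i` the diagonals `b_{i-1}` and
`b_i`, where `b_i` joins `Q_{4g}` to `Q_{i+1}`. -/
def beta (P : CanonicalPolygon g) (i : ℕ) : ℝ :=
  hypAngle (P.vertex (4 * g : ℕ)) (P.vertex i) (P.vertex (i + 1))

/-- The angle `φ_1` at `Q_2` between the diagonal `b_1`, which joins `Q_{4g}` to `Q_2`, and the
side `a_2`, which joins `Q_1` to `Q_2`. -/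
def phiOne (P : CanonicalPolygon g) : ℝ :=
  hypAngle (P.vertex 2) (P.vertex (4 * g : ℕ)) (P.vertex 1)

/-- The `6 g - 5` angle parameters `θ_1, …, θ_{6g-5}`; the entry with index `k : Fin (6 * g - 5)`
is `θ_{k+1}`. Here `θ_i = α_i` for `1 ≤ i ≤ 4 g - 4`, `i ≠ 2 g + 1`, moreover `θ_{2g+1} = φ_1` and
`θ_{4g-4+i} = β_i` for `1 ≤ i ≤ 2 g - 1`. -/
def angleParameters (P : CanonicalPolygon g) (k : Fin (6 * g - 5)) : ℝ :=
  if k.val + 1 = 2 * g + 1 then P.phiOne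
  else if k.val + 1 ≤ 4 * g - 4 then P.angle (k.val + 1 : ℕ)
  else P.beta (k.val + 1 - (4 * g - 4))

/-- The topology on the set of canonical polygons in which convergence means convergence of all
side lengths and of all interior angles. -/
instance instTopologicalSpace : TopologicalSpace (CanonicalPolygon g) :=
  TopologicalSpace.induced
    (fun P : CanonicalPolygon g => (P.sideLength, P.angle)) inferInstance

/-- Two canonical polygons are equivalent if an isometry of the hyperbolic plane maps the side `a_i`
of the first to the side `a_i` of the second, for every `i`. -/
instance setoid (g : ℕ) : Setoid (CanonicalPolygon g) where
  r P P' := ∃ e : ℍ ≃ᵢ ℍ, ∀ i, e '' P.side i = P'.side i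
  iseqv :=
    { refl := fun P => ⟨IsometryEquiv.refl ℍ, fun i => Set.image_id _⟩
      symm := by
        rintro P P' ⟨e, he⟩
        refine ⟨e.symm, fun i => ?_⟩
        rw [← he i, ← Set.image_comp]
        have h : (⇑e.symm ∘ ⇑e) = id := funext fun z => e.symm_apply_apply z
        rw [h, Set.image_id]
      trans := by
        rintro P P' P'' ⟨e, he⟩ ⟨f, hf⟩
        refine ⟨e.trans f, fun i => ?_⟩
        rw [← hf i, ← he i, ← Set.image_comp]
        rfl }

end CanonicalPolygon

/-- The Teichmüller space `T_g`: equivalence classes of canonical polygons with `4 g` sides, with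
the quotient topology. Since side lengths and interior angles are invariant under equivalence, a
sequence of classes converges iff all side lengths and all interior angles converge. -/
abbrev TeichmullerSpace (g : ℕ) : Type :=
  Quotient (CanonicalPolygon.setoid g)

end

/-! The polygon is cut by its diagonals from $Q_{4g}$ into a fan of triangles, and hyperbolic
trigonometry rebuilds it from $\theta$. The first triangle has angles $\alpha_1,\beta_1,\phi_1$,
which determine its sides by the dual law of cosines. Each further triangle up to $Q_{2g}$ is given
by a known side and its two adjacent angles: $\beta_{j+1}$, and $\alpha_{j+1}$ minus the angle
already used up. This yields $a_1,\dots,a_{2g}$, and (i) gives the other sides. With all sides and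
$\alpha_1,\dots,\alpha_{4g-4}$ known, the fan continues by side-angle-side up to $Q_{4g-3}$.

There remains the quadrilateral $Q_{4g-3}Q_{4g-2}Q_{4g-1}Q_{4g}$ with known sides. By (ii) and (v),
$\alpha_{4g-3}+\alpha_{4g-1}$ is known, hence so is the sum of its two angles facing the diagonal
$Q_{4g-2}Q_{4g}$. Both grow with that diagonal, which is therefore determined
(`continuous_dist_diagonal`), and the last angles follow.

Every step is a continuity statement for a family of polygons over an arbitrary space $Y$. Taking
for $Y$ the set of polygons with either topology shows that $\theta$ induces the given topology
(`isInducing_angleParameters`). Injectivity then costs nothing: equal parameters mean topologically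
inseparable polygons, that is, equal sides and angles, and such polygons are equivalent
(`equiv_of_inseparable`). -/

/-! ### Hyperbolic trigonometry: the two laws of cosines. -/

theorem hypDir_re (z w : ℍ) : (hypDir z w).re =
    ((w.re - z.re) ^ 2 + w.im ^ 2 - z.im ^ 2) / ((w.re - z.re) ^ 2 + (w.im + z.im) ^ 2) := by
  simp only [hypDir, Complex.div_re, Complex.sub_re, Complex.sub_im, Complex.conj_re,
    Complex.conj_im, coe_re, coe_im, Complex.normSq_apply, ← add_div]
  congr 1 <;> ring

theorem hypDir_im (z w : ℍ) : (hypDir z w).im =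
    2 * z.im * (z.re - w.re) / ((w.re - z.re) ^ 2 + (w.im + z.im) ^ 2) := by
  simp only [hypDir, Complex.div_im, Complex.sub_re, Complex.sub_im, Complex.conj_re,
    Complex.conj_im, coe_re, coe_im, Complex.normSq_apply, ← sub_div]
  congr 1 <;> ring

theorem hypDir_denom_pos (z w : ℍ) : 0 < (w.re - z.re) ^ 2 + (w.im + z.im) ^ 2 := by
  have := z.im_pos
  have := w.im_pos
  positivity

theorem norm_hypDir (z w : ℍ) : ‖hypDir z w‖ = Real.tanh (dist z w / 2) := by
  rw [tanh_half_dist, hypDir, norm_div, dist_eq_norm, dist_eq_norm, norm_sub_rev,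
    ← Complex.norm_conj ((w : ℂ) - (starRingEnd ℂ) (z : ℂ)), map_sub, Complex.conj_conj,
    norm_sub_rev ((starRingEnd ℂ) (w : ℂ))]

theorem hypDir_eq_zero {z w : ℍ} : hypDir z w = 0 ↔ z = w := by
  rw [← norm_eq_zero, norm_hypDir, Real.tanh_eq_sinh_div_cosh, div_eq_zero_iff]
  simp [(Real.cosh_pos _).ne', Real.sinh_eq_zero]

theorem cosh_dist_eq (z w : ℍ) : Real.cosh (dist z w) =
    1 + ((w.re - z.re) ^ 2 + (w.im - z.im) ^ 2) / (2 * z.im * w.im) := by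
  rw [cosh_dist, dist_comm, Complex.dist_eq, Complex.sq_norm, Complex.normSq_apply]
  simp only [Complex.sub_re, Complex.sub_im, coe_re, coe_im]
  congr 2
  ring

theorem sinh_dist_eq (z w : ℍ) : Real.sinh (dist z w) =
    ‖hypDir z w‖ * ((w.re - z.re) ^ 2 + (w.im + z.im) ^ 2) / (2 * z.im * w.im) := by
  have hz := z.im_pos
  have hw := w.im_pos
  have h1 : Real.sinh (dist z w) = 2 * Real.sinh (dist z w / 2) * Real.cosh (dist z w / 2) := by
    rw [← Real.sinh_two_mul]; congr 1; ring
  have h2 : Real.sinh (dist z w) = 2 * Real.cosh (dist z w / 2) ^ 2 * ‖hypDir z w‖ := by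
    rw [h1, norm_hypDir, Real.tanh_eq_sinh_div_cosh]
    have := (Real.cosh_pos (dist z w / 2)).ne'
    field_simp
  have h3 : 2 * Real.cosh (dist z w / 2) ^ 2 = Real.cosh (dist z w) + 1 := by
    have := Real.cosh_two_mul (dist z w / 2)
    rw [mul_div_cancel₀ _ two_ne_zero] at this
    have := Real.cosh_sq (dist z w / 2)
    linarith
  rw [h2, h3, cosh_dist_eq]
  field_simp
  ring

theorem cosh_dist_law_of_cosines (z x y : ℍ) : Real.cosh (dist x y) =
    Real.cosh (dist z x) * Real.cosh (dist z y) -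
      Real.sinh (dist z x) * Real.sinh (dist z y) * Real.cos (hypAngle z x y) := by
  have h := InnerProductGeometry.cos_angle_mul_norm_mul_norm (hypDir z x) (hypDir z y)
  rw [Complex.inner, Complex.mul_re, Complex.conj_re, Complex.conj_im, hypDir_re, hypDir_re,
    hypDir_im, hypDir_im] at h
  have hN := (hypDir_denom_pos z x).ne'
  have hM := (hypDir_denom_pos z y).ne'
  have hz := z.im_pos.ne'
  have hx := x.im_pos.ne'
  have hy := y.im_pos.ne'
  have key : Real.sinh (dist z x) * Real.sinh (dist z y) * Real.cos (hypAngle z x y) =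
      (Real.cos (hypAngle z x y) * (‖hypDir z x‖ * ‖hypDir z y‖)) *
      (((x.re - z.re) ^ 2 + (x.im + z.im) ^ 2) / (2 * z.im * x.im)) *
      (((y.re - z.re) ^ 2 + (y.im + z.im) ^ 2) / (2 * z.im * y.im)) := by
    rw [sinh_dist_eq, sinh_dist_eq]; ring
  rw [key, hypAngle, h, cosh_dist_eq, cosh_dist_eq, cosh_dist_eq]
  field_simp
  ring

theorem hypAngle_comm (z x y : ℍ) : hypAngle z x y = hypAngle z y x :=
  InnerProductGeometry.angle_comm _ _

theorem hypAngle_nonneg (z x y : ℍ) : 0 ≤ hypAngle z x y := InnerProductGeometry.angle_nonneg _ _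

theorem hypAngle_le_pi (z x y : ℍ) : hypAngle z x y ≤ Real.pi := InnerProductGeometry.angle_le_pi _ _

theorem hypAngle_self {z x : ℍ} (h : z ≠ x) : hypAngle z x x = 0 :=
  InnerProductGeometry.angle_self (mt hypDir_eq_zero.1 h)

theorem sinh_dist_pos {z x : ℍ} (h : z ≠ x) : 0 < Real.sinh (dist z x) :=
  Real.sinh_pos_iff.2 (dist_pos.2 h)

theorem cos_hypAngle {z x y : ℍ} (hx : z ≠ x) (hy : z ≠ y) : Real.cos (hypAngle z x y) =
    (Real.cosh (dist z x) * Real.cosh (dist z y) - Real.cosh (dist x y)) /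
      (Real.sinh (dist z x) * Real.sinh (dist z y)) := by
  have := (sinh_dist_pos hx).ne'
  have := (sinh_dist_pos hy).ne'
  rw [cosh_dist_law_of_cosines z x y]
  field_simp
  ring

theorem hypAngle_eq_arccos {z x y : ℍ} (hx : z ≠ x) (hy : z ≠ y) : hypAngle z x y =
    Real.arccos ((Real.cosh (dist z x) * Real.cosh (dist z y) - Real.cosh (dist x y)) /
      (Real.sinh (dist z x) * Real.sinh (dist z y))) := by
  rw [← cos_hypAngle hx hy, Real.arccos_cos (hypAngle_nonneg _ _ _) (hypAngle_le_pi _ _ _)]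

theorem hypAngle_map_isometry {e : ℍ → ℍ} (he : Isometry e) {z x y : ℍ} (hx : z ≠ x)
    (hy : z ≠ y) : hypAngle (e z) (e x) (e y) = hypAngle z x y := by
  rw [hypAngle_eq_arccos hx hy, hypAngle_eq_arccos (he.injective.ne hx) (he.injective.ne hy)]
  simp only [he.dist_eq]

/-- The right side is symmetric in the three side lengths, which is what makes this a law of sines.
-/
theorem sin_hypAngle_mul_sq (z x y : ℍ) :
    (Real.sin (hypAngle z x y) * (Real.sinh (dist z x) * Real.sinh (dist z y))) ^ 2 =
      1 + 2 * Real.cosh (dist z x) * Real.cosh (dist z y) * Real.cosh (dist x y) -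
        Real.cosh (dist z x) ^ 2 - Real.cosh (dist z y) ^ 2 - Real.cosh (dist x y) ^ 2 := by
  rw [mul_pow, Real.sin_sq, mul_pow, sub_mul, one_mul]
  have h : Real.cos (hypAngle z x y) ^ 2 * (Real.sinh (dist z x) ^ 2 * Real.sinh (dist z y) ^ 2) =
      (Real.cosh (dist z x) * Real.cosh (dist z y) - Real.cosh (dist x y)) ^ 2 := by
    rw [cosh_dist_law_of_cosines z x y]; ring
  rw [h, Real.sinh_sq, Real.sinh_sq]
  ring

theorem sin_hypAngle_nonneg (z x y : ℍ) : 0 ≤ Real.sin (hypAngle z x y) :=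
  Real.sin_nonneg_of_nonneg_of_le_pi (hypAngle_nonneg _ _ _) (hypAngle_le_pi _ _ _)

theorem cos_hypAngle_law_of_cosines {x y z : ℍ} (hxy : x ≠ y) (hyz : y ≠ z) (hzx : z ≠ x) :
    Real.cos (hypAngle z x y) = Real.sin (hypAngle x y z) * Real.sin (hypAngle y z x) *
      Real.cosh (dist x y) - Real.cos (hypAngle x y z) * Real.cos (hypAngle y z x) := by
  have sa := sinh_dist_pos hyz
  have sb := sinh_dist_pos hzx
  have sc := sinh_dist_pos hxy
  have h1 := sin_hypAngle_mul_sq x y z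
  have h2 := sin_hypAngle_mul_sq y z x
  rw [dist_comm y x, dist_comm x z] at *
  -- Law of sines: both sides are nonnegative and have the same symmetric square.
  have h3 : Real.sin (hypAngle x y z) * (Real.sinh (dist x y) * Real.sinh (dist z x)) =
      Real.sin (hypAngle y z x) * (Real.sinh (dist y z) * Real.sinh (dist x y)) := by
    refine (pow_left_inj₀ ?_ ?_ two_ne_zero).1 (by rw [h1, h2]; ring)
    · exact mul_nonneg (sin_hypAngle_nonneg _ _ _) (by positivity)
    · exact mul_nonneg (sin_hypAngle_nonneg _ _ _) (by positivity)
  have h4 : Real.sin (hypAngle x y z) * Real.sin (hypAngle y z x) =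
      (1 + 2 * Real.cosh (dist x y) * Real.cosh (dist z x) * Real.cosh (dist y z) -
        Real.cosh (dist x y) ^ 2 - Real.cosh (dist z x) ^ 2 - Real.cosh (dist y z) ^ 2) /
      (Real.sinh (dist z x) * Real.sinh (dist y z) * Real.sinh (dist x y) ^ 2) := by
    rw [← h1, eq_div_iff (by positivity), h3]
    linear_combination
      (Real.sin (hypAngle y z x) * (Real.sinh (dist y z) * Real.sinh (dist x y))) * h3
  rw [h4, cos_hypAngle hzx hyz.symm, cos_hypAngle hxy hzx.symm, cos_hypAngle hyz hxy.symm,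
    dist_comm z y, dist_comm x z, dist_comm y x]
  have hc := Real.sinh_sq (dist x y)
  field_simp
  rw [hc]
  ring

/-! ### Orientation of triangles and additivity of angles. -/

/-- In the coordinates $(\mathrm{Re}\,z,|z|^2)$ geodesics are straight lines, and the expression is
the planar orientation determinant. This form makes cyclic symmetry visible. -/
theorem isRightOf_iff (x y z : ℍ) : IsRightOf x y z ↔
    (x.re - z.re) * (y.re ^ 2 + y.im ^ 2 - x.re ^ 2 - x.im ^ 2) -
      (x.re - y.re) * (z.re ^ 2 + z.im ^ 2 - x.re ^ 2 - x.im ^ 2) < 0 := by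
  rcases eq_or_ne x y with rfl | h
  · rw [IsRightOf, hypDir_eq_zero.2 rfl]
    simp
  have hn : 0 < Complex.normSq (hypDir x y) := Complex.normSq_pos.2 (mt hypDir_eq_zero.1 h)
  have hN := hypDir_denom_pos x y
  have hM := hypDir_denom_pos x z
  have hx := x.im_pos
  have : (hypDir x z / hypDir x y).im = 2 * x.im / (Complex.normSq (hypDir x y) *
      ((y.re - x.re) ^ 2 + (y.im + x.im) ^ 2) * ((z.re - x.re) ^ 2 + (z.im + x.im) ^ 2)) *
      ((x.re - z.re) * (y.re ^ 2 + y.im ^ 2 - x.re ^ 2 - x.im ^ 2) -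
      (x.re - y.re) * (z.re ^ 2 + z.im ^ 2 - x.re ^ 2 - x.im ^ 2)) := by
    rw [Complex.div_im, hypDir_re, hypDir_im, hypDir_re, hypDir_im]
    generalize Complex.normSq (hypDir x y) = n at hn
    field_simp
    ring
  rw [IsRightOf, this]
  have hc : 0 < 2 * x.im / (Complex.normSq (hypDir x y) *
      ((y.re - x.re) ^ 2 + (y.im + x.im) ^ 2) * ((z.re - x.re) ^ 2 + (z.im + x.im) ^ 2)) := by
    positivity
  exact ⟨fun h => by_contra fun h' => absurd h (not_lt.2 (mul_nonneg hc.le (not_lt.1 h'))),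
    fun h => mul_neg_of_pos_of_neg hc h⟩

theorem IsRightOf.rotate {x y z : ℍ} (h : IsRightOf x y z) : IsRightOf y z x := by
  rw [isRightOf_iff] at *
  linarith

theorem IsRightOf.ne₁₂ {x y z : ℍ} (h : IsRightOf x y z) : x ≠ y := by
  rintro rfl
  rw [isRightOf_iff] at h
  linarith

theorem IsRightOf.ne₂₃ {x y z : ℍ} (h : IsRightOf x y z) : y ≠ z := h.rotate.ne₁₂

theorem IsRightOf.ne₃₁ {x y z : ℍ} (h : IsRightOf x y z) : z ≠ x := h.rotate.rotate.ne₁₂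

theorem IsRightOf.arg_lt_zero {x y z : ℍ} (h : IsRightOf x y z) :
    (hypDir x z / hypDir x y).arg < 0 := Complex.arg_neg_iff.2 h

theorem IsRightOf.hypAngle_eq {x y z : ℍ} (h : IsRightOf x y z) :
    hypAngle x y z = -(hypDir x z / hypDir x y).arg := by
  rw [hypAngle_comm, hypAngle, Complex.angle_eq_abs_arg (mt hypDir_eq_zero.1 h.ne₃₁.symm)
    (mt hypDir_eq_zero.1 h.ne₁₂), abs_of_neg h.arg_lt_zero]

theorem IsRightOf.hypAngle_pos {x y z : ℍ} (h : IsRightOf x y z) : 0 < hypAngle x y z := by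
  rw [h.hypAngle_eq]
  linarith [h.arg_lt_zero]

theorem IsRightOf.hypAngle_lt_pi {x y z : ℍ} (h : IsRightOf x y z) :
    hypAngle x y z < Real.pi := by
  rw [h.hypAngle_eq]
  linarith [Complex.neg_pi_lt_arg (hypDir x z / hypDir x y)]

theorem IsRightOf.sin_hypAngle_pos {x y z : ℍ} (h : IsRightOf x y z) :
    0 < Real.sin (hypAngle x y z) :=
  Real.sin_pos_of_pos_of_lt_pi h.hypAngle_pos h.hypAngle_lt_pi

theorem hypAngle_add {z x y w : ℍ} (hxy : IsRightOf z x y) (hyw : IsRightOf z y w)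
    (hxw : IsRightOf z x w) : hypAngle z x y + hypAngle z y w = hypAngle z x w := by
  have hx := mt hypDir_eq_zero.1 hxy.ne₁₂
  have hy := mt hypDir_eq_zero.1 hyw.ne₁₂
  have hw := mt hypDir_eq_zero.1 hyw.ne₃₁.symm
  have hmul : hypDir z w / hypDir z x =
      hypDir z w / hypDir z y * (hypDir z y / hypDir z x) := by field_simp
  have hpos : 0 < Real.sin (hypAngle z x y + hypAngle z y w) := by
    have h := hxw
    rw [IsRightOf, hmul, ← Complex.norm_mul_exp_arg_mul_I (hypDir z w / hypDir z y),
      ← Complex.norm_mul_exp_arg_mul_I (hypDir z y / hypDir z x), mul_mul_mul_comm,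
      ← Complex.exp_add, ← add_mul, ← Complex.ofReal_add, ← Complex.ofReal_mul,
      Complex.im_ofReal_mul, Complex.exp_ofReal_mul_I_im] at h
    rw [hxy.hypAngle_eq, hyw.hypAngle_eq, ← neg_add, Real.sin_neg, add_comm]
    by_contra hc
    exact absurd h (not_lt.2 (mul_nonneg (by positivity) (by linarith)))
  -- A sum in $[\pi,2\pi)$ would have nonpositive sine. Hence the arguments add without wrapping
  -- around.
  have hlt : hypAngle z x y + hypAngle z y w < Real.pi := by
    by_contra! hc
    have := Real.sin_nonneg_of_nonneg_of_le_pi (sub_nonneg.2 hc)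
      (by linarith [hxy.hypAngle_lt_pi, hyw.hypAngle_lt_pi])
    rw [Real.sin_sub_pi] at this
    linarith
  rw [hxw.hypAngle_eq, hmul, (Complex.arg_mul_eq_add_arg_iff (div_ne_zero hw hy)
    (div_ne_zero hy hx)).2, hxy.hypAngle_eq, hyw.hypAngle_eq]
  · ring
  · rw [hxy.hypAngle_eq, hyw.hypAngle_eq] at hlt
    constructor <;> linarith [hxy.arg_lt_zero, hyw.arg_lt_zero, Real.pi_pos]

/-! ### Geodesic segments, and isometries with prescribed rotation. -/

theorem dist_of_hypAngle_eq_zero {x z w : ℍ} (h : hypAngle x z w = 0) :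
    dist z w = |dist x z - dist x w| := by
  have := cosh_dist_law_of_cosines x z w
  rw [h, Real.cos_zero, mul_one, ← Real.cosh_sub] at this
  refine le_antisymm ?_ ?_
  · simpa using Real.cosh_le_cosh.1 this.le
  · simpa using Real.cosh_le_cosh.1 this.ge

theorem hypAngle_eq_zero_of_mem_hypSegment {x y z : ℍ} (hxy : x ≠ y) (hxz : x ≠ z)
    (hz : z ∈ hypSegment x y) : hypAngle x y z = 0 := by
  have hd : dist z y = dist x y - dist x z := by linarith [show dist x z + dist z y = dist x y from hz]
  rw [hypAngle_eq_arccos hxy hxz, dist_comm y z, hd, Real.cosh_sub, sub_sub_cancel, div_self,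
    Real.arccos_one]
  exact mul_ne_zero (sinh_dist_pos hxy).ne' (sinh_dist_pos hxz).ne'

theorem dist_of_mem_hypSegment {x y z w : ℍ} (hxy : x ≠ y) (hz : z ∈ hypSegment x y)
    (hw : w ∈ hypSegment x y) : dist z w = |dist x z - dist x w| := by
  rcases eq_or_ne x z with rfl | hxz
  · simp
  rcases eq_or_ne x w with rfl | hxw
  · simp [dist_comm]
  apply dist_of_hypAngle_eq_zero
  obtain ⟨-, r, hr, hr'⟩ := InnerProductGeometry.angle_eq_zero_iff.1
    (hypAngle_eq_zero_of_mem_hypSegment hxy hxz hz)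
  obtain ⟨-, s, hs, hs'⟩ := InnerProductGeometry.angle_eq_zero_iff.1
    (hypAngle_eq_zero_of_mem_hypSegment hxy hxw hw)
  rw [hypAngle, hr', hs', InnerProductGeometry.angle_smul_left_of_pos _ _ hr,
    InnerProductGeometry.angle_smul_right_of_pos _ _ hs,
    InnerProductGeometry.angle_self (mt hypDir_eq_zero.1 hxy)]

theorem left_mem_hypSegment (x y : ℍ) : x ∈ hypSegment x y := by simp [hypSegment]

theorem right_mem_hypSegment (x y : ℍ) : y ∈ hypSegment x y := by simp [hypSegment]

theorem dist_le_of_mem_hypSegment {x y z w : ℍ} (hz : z ∈ hypSegment x y)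
    (hw : w ∈ hypSegment x y) : dist z w ≤ dist x y := by
  have h1 : dist x z + dist z y = dist x y := hz
  have h2 : dist x w + dist w y = dist x y := hw
  have h3 := dist_triangle_left z w x
  have h4 := dist_triangle_right z w y
  linarith

/-- The endpoints are the only pair of points of a segment whose distance equals its diameter. -/
theorem endpoints_of_hypSegment_eq {x y x' y' : ℍ} (hxy : x ≠ y)
    (h : hypSegment x y = hypSegment x' y') : x = x' ∧ y = y' ∨ x = y' ∧ y = x' := by
  have hx' : x' ∈ hypSegment x y := h ▸ left_mem_hypSegment x' y'
  have hy' : y' ∈ hypSegment x y := h ▸ right_mem_hypSegment x' y'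
  have hd : dist x' y' = dist x y := le_antisymm (dist_le_of_mem_hypSegment hx' hy')
    (dist_le_of_mem_hypSegment (h ▸ left_mem_hypSegment x y) (h ▸ right_mem_hypSegment x y))
  rw [dist_of_mem_hypSegment hxy hx' hy'] at hd
  have h1 : dist x x' + dist x' y = dist x y := hx'
  have h2 : dist x y' + dist y' y = dist x y := hy'
  have p1 : 0 ≤ dist x x' := dist_nonneg
  have p2 : 0 ≤ dist x' y := dist_nonneg
  have p3 : 0 ≤ dist x y' := dist_nonneg
  have p4 : 0 ≤ dist y' y := dist_nonneg
  rcases abs_choice (dist x x' - dist x y') with hs | hs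
  · right
    exact ⟨dist_le_zero.1 (by linarith), (dist_le_zero.1 (by linarith : dist x' y ≤ 0)).symm⟩
  · left
    exact ⟨dist_le_zero.1 (by linarith), (dist_le_zero.1 (by linarith : dist y' y ≤ 0)).symm⟩

theorem image_hypSegment (e : ℍ ≃ᵢ ℍ) (x y : ℍ) :
    e '' hypSegment x y = hypSegment (e x) (e y) := by
  ext z
  obtain ⟨z, rfl⟩ := e.surjective z
  simp [hypSegment, e.isometry.dist_eq]

theorem smul_denom_ne_zero (g : Matrix.SpecialLinearGroup (Fin 2) ℝ) (z : ℍ) :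
    (g 1 0 * z + g 1 1 : ℂ) ≠ 0 := denom_ne_zero (g : GL (Fin 2) ℝ) z

theorem hypDir_smul (g : Matrix.SpecialLinearGroup (Fin 2) ℝ) (z w : ℍ) :
    hypDir (g • z) (g • w) = (starRingEnd ℂ) (g 1 0 * z + g 1 1 : ℂ) / (g 1 0 * z + g 1 1 : ℂ) *
      hypDir z w := by
  have hz := smul_denom_ne_zero g z
  have hw := smul_denom_ne_zero g w
  have hz' : (g 1 0 * (starRingEnd ℂ) z + g 1 1 : ℂ) ≠ 0 := by
    simpa using (map_ne_zero (starRingEnd ℂ)).2 hz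
  have hdet : (g 0 0 * g 1 1 - g 0 1 * g 1 0 : ℂ) = 1 := by
    have := g.det_coe
    rw [Matrix.det_fin_two] at this
    exact_mod_cast this
  have h0 : (w : ℂ) - (starRingEnd ℂ) z ≠ 0 := by
    intro h
    have := congrArg Complex.im h
    simp only [Complex.sub_im, Complex.conj_im, coe_im, Complex.zero_im] at this
    linarith [z.im_pos, w.im_pos]
  have h1 : ((g • w : ℍ) : ℂ) - (g • z : ℍ) =
      (w - z) / ((g 1 0 * w + g 1 1) * (g 1 0 * z + g 1 1)) := by
    rw [coe_specialLinearGroup_apply, coe_specialLinearGroup_apply]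
    simp only [Algebra.algebraMap_self, RingHom.id_apply]
    rw [div_sub_div _ _ hw hz]
    congr 1
    linear_combination (w - z : ℂ) * hdet
  have h2 : ((g • w : ℍ) : ℂ) - (starRingEnd ℂ) (g • z : ℍ) =
      (w - (starRingEnd ℂ) z) /
        ((g 1 0 * w + g 1 1) * (g 1 0 * (starRingEnd ℂ) (z : ℂ) + g 1 1)) := by
    rw [coe_specialLinearGroup_apply, coe_specialLinearGroup_apply]
    simp only [Algebra.algebraMap_self, RingHom.id_apply, map_div₀, map_add, map_mul,
      Complex.conj_ofReal]
    rw [div_sub_div _ _ hw hz']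
    congr 1
    linear_combination (w - (starRingEnd ℂ) z : ℂ) * hdet
  rw [hypDir, h1, h2, hypDir]
  simp only [map_add, map_mul, Complex.conj_ofReal]
  rw [div_div_div_eq, div_mul_div_comm, div_eq_div_iff (mul_ne_zero (mul_ne_zero hw hz) h0)
    (mul_ne_zero hz h0)]
  ring

/-- Move $z$ to $i$, rotate about $i$, then move $i$ to $z'$. The two moves contribute unit factors
`a` and `b`, which the rotation corrects to $c$. -/
theorem exists_isometry_hypDir (z z' : ℍ) {c : ℂ} (hc : ‖c‖ = 1) :
    ∃ e : ℍ ≃ᵢ ℍ, e z = z' ∧ ∀ w, hypDir z' (e w) = c * hypDir z w := by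
  have norm_one : ∀ (g : Matrix.SpecialLinearGroup (Fin 2) ℝ) (z : ℍ),
      ‖(starRingEnd ℂ) (g 1 0 * z + g 1 1 : ℂ) / (g 1 0 * z + g 1 1 : ℂ)‖ = 1 := fun g z => by
    rw [norm_div, Complex.norm_conj,
      div_self (norm_ne_zero_iff.2 (smul_denom_ne_zero g z))]
  obtain ⟨g, hg⟩ := MulAction.exists_smul_eq (Matrix.SpecialLinearGroup (Fin 2) ℝ) z I
  obtain ⟨h, hh⟩ := MulAction.exists_smul_eq (Matrix.SpecialLinearGroup (Fin 2) ℝ) I z'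
  have hga := fun w => hypDir_smul g z w
  have hhb := fun w => hypDir_smul h I w
  have ha1 := norm_one g z
  have hb1 := norm_one h I
  generalize (starRingEnd ℂ) (g 1 0 * z + g 1 1 : ℂ) / (g 1 0 * z + g 1 1 : ℂ) = a at hga ha1
  generalize (starRingEnd ℂ) (h 1 0 * (I : ℍ) + h 1 1 : ℂ) / (h 1 0 * (I : ℍ) + h 1 1 : ℂ) = b
    at hhb hb1
  have ha0 : a ≠ 0 := norm_ne_zero_iff.1 (ha1 ▸ one_ne_zero)
  have hb0 : b ≠ 0 := norm_ne_zero_iff.1 (hb1 ▸ one_ne_zero)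
  -- The factor 2 appears because the rotation matrix of angle $t$ turns directions at $i$ by $2t$.
  obtain ⟨t, ht⟩ : ∃ t : ℝ, c / (a * b) = Complex.exp (2 * t * Complex.I) := by
    refine ⟨(c / (a * b)).arg / 2, ?_⟩
    have hd : ‖c / (a * b)‖ = 1 := by rw [norm_div, norm_mul, ha1, hb1, hc]; norm_num
    conv_lhs => rw [← Complex.norm_mul_exp_arg_mul_I (c / (a * b)), hd, Complex.ofReal_one, one_mul]
    congr 1
    push_cast
    ring
  let k : Matrix.SpecialLinearGroup (Fin 2) ℝ :=
    ⟨!![Real.cos t, Real.sin t; -Real.sin t, Real.cos t], by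
      rw [Matrix.det_fin_two_of]; linarith [Real.sin_sq_add_cos_sq t]⟩
  have hkd : (k 1 0 * (I : ℍ) + k 1 1 : ℂ) = Complex.exp (-(t * Complex.I)) := by
    rw [← neg_mul, Complex.exp_mul_I]
    simp [k]
    ring
  have hkI : k • I = I := by
    ext
    rw [coe_specialLinearGroup_apply]
    simp only [Algebra.algebraMap_self, RingHom.id_apply]
    rw [div_eq_iff (smul_denom_ne_zero k I)]
    simp [k]
    linear_combination Complex.sin t * Complex.I_sq
  have hkc : ∀ w, hypDir I (k • w) = c / (a * b) * hypDir I w := fun w => by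
    conv_lhs => rw [← hkI]
    rw [hypDir_smul, hkd, ht, ← Complex.exp_conj, ← Complex.exp_sub]
    congr 2
    simp
    ring
  refine ⟨((IsometryEquiv.constSMul g).trans (IsometryEquiv.constSMul k)).trans
    (IsometryEquiv.constSMul h), by simp [hg, hkI, hh], fun w => ?_⟩
  simp only [IsometryEquiv.trans_apply, IsometryEquiv.constSMul_apply]
  rw [← hh, hhb, hkc, ← hg, hga]
  field_simp

theorem hypDir_injective (z : ℍ) : Function.Injective (hypDir z) := by
  intro x y h
  rcases eq_or_ne z x with rfl | hx
  · rw [hypDir_eq_zero.2 rfl] at h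
    exact hypDir_eq_zero.1 h.symm
  have hd : dist z x = dist z y := by
    have h1 := norm_hypDir z x
    rw [h, norm_hypDir] at h1
    linarith [Real.tanh_injective h1]
  rw [← dist_le_zero, dist_of_hypAngle_eq_zero (x := z), hd, sub_self, abs_zero]
  rw [hypAngle, h, InnerProductGeometry.angle_self]
  rw [← h]
  exact mt hypDir_eq_zero.1 hx

/-! ### The congruence cases SSS, SAS, ASA and AAA of triangles in continuous form, and the
quadrilateral. -/

section Continuity

variable {Y : Type*} [TopologicalSpace Y]

theorem continuous_of_continuous_cosh {f : Y → ℝ} (hf : ∀ y, 0 ≤ f y)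
    (h : Continuous fun y => Real.cosh (f y)) : Continuous f := by
  have : f = fun y => Real.arcosh (Real.cosh (f y)) :=
    funext fun y => (Real.arcosh_cosh (hf y)).symm
  rw [this]
  exact Real.continuousOn_arcosh.comp_continuous h fun y => Real.one_le_cosh _

theorem continuous_hypAngle_of_dist {z x y : Y → ℍ} (hzx : ∀ t, z t ≠ x t) (hzy : ∀ t, z t ≠ y t)
    (h₁ : Continuous fun t => dist (z t) (x t)) (h₂ : Continuous fun t => dist (z t) (y t))
    (h₃ : Continuous fun t => dist (x t) (y t)) :
    Continuous fun t => hypAngle (z t) (x t) (y t) := by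
  simp only [fun t => hypAngle_eq_arccos (hzx t) (hzy t)]
  refine Real.continuous_arccos.comp (Continuous.div (by fun_prop) (by fun_prop) fun t => ?_)
  exact mul_ne_zero (sinh_dist_pos (hzx t)).ne' (sinh_dist_pos (hzy t)).ne'

theorem continuous_dist_of_hypAngle {z x y : Y → ℍ}
    (h₁ : Continuous fun t => dist (z t) (x t)) (h₂ : Continuous fun t => dist (z t) (y t))
    (h₃ : Continuous fun t => hypAngle (z t) (x t) (y t)) :
    Continuous fun t => dist (x t) (y t) := by
  refine continuous_of_continuous_cosh (fun _ => dist_nonneg) ?_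
  simp only [fun t => cosh_dist_law_of_cosines (z t) (x t) (y t)]
  fun_prop

theorem continuous_hypAngle_of_hypAngle {x y z : Y → ℍ} (hxy : ∀ t, x t ≠ y t)
    (hyz : ∀ t, y t ≠ z t) (hzx : ∀ t, z t ≠ x t)
    (h₁ : Continuous fun t => hypAngle (x t) (y t) (z t))
    (h₂ : Continuous fun t => hypAngle (y t) (z t) (x t))
    (h₃ : Continuous fun t => dist (x t) (y t)) :
    Continuous fun t => hypAngle (z t) (x t) (y t) := by
  have : (fun t => hypAngle (z t) (x t) (y t)) =
      fun t => Real.arccos (Real.cos (hypAngle (z t) (x t) (y t))) :=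
    funext fun t => (Real.arccos_cos (hypAngle_nonneg _ _ _) (hypAngle_le_pi _ _ _)).symm
  rw [this]
  simp only [fun t => cos_hypAngle_law_of_cosines (hxy t) (hyz t) (hzx t)]
  fun_prop

theorem continuous_dist_of_hypAngles {x y z : Y → ℍ} (h : ∀ t, IsRightOf (x t) (y t) (z t))
    (h₁ : Continuous fun t => hypAngle (x t) (y t) (z t))
    (h₂ : Continuous fun t => hypAngle (y t) (z t) (x t))
    (h₃ : Continuous fun t => hypAngle (z t) (x t) (y t)) :
    Continuous fun t => dist (x t) (y t) := by
  refine continuous_of_continuous_cosh (fun _ => dist_nonneg) ?_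
  have hne : ∀ t, Real.sin (hypAngle (x t) (y t) (z t)) *
      Real.sin (hypAngle (y t) (z t) (x t)) ≠ 0 := fun t =>
    mul_ne_zero (h t).sin_hypAngle_pos.ne' (h t).rotate.sin_hypAngle_pos.ne'
  have : (fun t => Real.cosh (dist (x t) (y t))) = fun t =>
      (Real.cos (hypAngle (z t) (x t) (y t)) +
        Real.cos (hypAngle (x t) (y t) (z t)) * Real.cos (hypAngle (y t) (z t) (x t))) /
      (Real.sin (hypAngle (x t) (y t) (z t)) * Real.sin (hypAngle (y t) (z t) (x t))) := by
    funext t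
    rw [cos_hypAngle_law_of_cosines (h t).ne₁₂ (h t).ne₂₃ (h t).ne₃₁, sub_add_cancel,
      mul_div_cancel_left₀ _ (hne t)]
  rw [this]
  exact Continuous.div (by fun_prop) (by fun_prop) hne

/-- An implicit function theorem by order alone: a strict inequality between $F(y,a)$ and
$F(y,u(y))$ persists near $y_0$, and monotonicity turns it into one between $a$ and $u(y)$. -/
theorem continuous_of_monotone_implicit {F : Y → ℝ → ℝ} {u : Y → ℝ}
    (hF : ∀ v, Continuous fun y => F y v) (hmono : ∀ y, Monotone (F y))
    (hne : ∀ y v, v ≠ u y → F y v ≠ F y (u y)) (hu : Continuous fun y => F y (u y)) :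
    Continuous u := by
  refine continuous_iff_continuousAt.2 fun y₀ => tendsto_order.2 ⟨fun a ha => ?_, fun a ha => ?_⟩
  · have h := (hmono y₀ ha.le).lt_of_ne (hne y₀ a ha.ne)
    filter_upwards [(hF a).continuousAt.eventually_lt hu.continuousAt h] with y hy
    exact (hmono y).reflect_lt hy
  · have h := (hmono y₀ ha.le).lt_of_ne (hne y₀ a ha.ne').symm
    filter_upwards [hu.continuousAt.eventually_lt (hF a).continuousAt h] with y hy
    exact (hmono y).reflect_lt hy

/-- `Real.arccos` is constant outside $[-1,1]$; a value strictly between $0$ and $\pi$ excludes that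
range. -/
theorem arccos_ne_arccos {a b : ℝ} (h₀ : 0 < Real.arccos a) (h₁ : Real.arccos a < Real.pi)
    (hab : a ≠ b) : Real.arccos b ≠ Real.arccos a := by
  intro h
  have ha1 : a < 1 := Real.arccos_pos.1 h₀
  have ha2 : -1 < a := by
    by_contra! hc
    exact h₁.ne (Real.arccos_eq_pi.2 hc)
  have hb1 : b < 1 := Real.arccos_pos.1 (h ▸ h₀)
  have hb2 : -1 < b := by
    by_contra! hc
    exact (h ▸ h₁).ne (Real.arccos_eq_pi.2 hc)
  exact hab (Real.arccos_injOn ⟨ha2.le, ha1.le⟩ ⟨hb2.le, hb1.le⟩ h.symm)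

/-- The diagonal `b d` of a quadrilateral `a b c d` depends continuously on the sides and on the sum
of the two angles opposite to that diagonal. -/
theorem continuous_dist_diagonal {a b c d : Y → ℍ} (ha : ∀ t, IsRightOf (a t) (b t) (d t))
    (hcb : ∀ t, c t ≠ b t) (hcd : ∀ t, c t ≠ d t)
    (hab : Continuous fun t => dist (a t) (b t)) (had : Continuous fun t => dist (a t) (d t))
    (hbc : Continuous fun t => dist (c t) (b t)) (hdc : Continuous fun t => dist (c t) (d t))
    (h : Continuous fun t => hypAngle (a t) (b t) (d t) + hypAngle (c t) (b t) (d t)) :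
    Continuous fun t => dist (b t) (d t) := by
  refine continuous_of_continuous_cosh (fun _ => dist_nonneg) ?_
  have hs₁ := fun t => mul_pos (sinh_dist_pos (ha t).ne₁₂) (sinh_dist_pos (ha t).ne₃₁.symm)
  have hs₂ := fun t => mul_pos (sinh_dist_pos (hcb t)) (sinh_dist_pos (hcd t))
  -- Here $v$ stands for the hyperbolic cosine of the diagonal. The clamped `Real.arccos` keeps both
  -- functions monotone on all of $\mathbb R$.
  let F₁ : Y → ℝ → ℝ := fun t v =>
    Real.arccos ((Real.cosh (dist (a t) (b t)) * Real.cosh (dist (a t) (d t)) - v) /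
      (Real.sinh (dist (a t) (b t)) * Real.sinh (dist (a t) (d t))))
  let F₂ : Y → ℝ → ℝ := fun t v =>
    Real.arccos ((Real.cosh (dist (c t) (b t)) * Real.cosh (dist (c t) (d t)) - v) /
      (Real.sinh (dist (c t) (b t)) * Real.sinh (dist (c t) (d t))))
  have m₁ : ∀ t, Monotone (F₁ t) := fun t v w hvw => Real.antitone_arccos
    (div_le_div_of_nonneg_right (sub_le_sub_left hvw _) (hs₁ t).le)
  have m₂ : ∀ t, Monotone (F₂ t) := fun t v w hvw => Real.antitone_arccos
    (div_le_div_of_nonneg_right (sub_le_sub_left hvw _) (hs₂ t).le)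
  have e₁ : ∀ t, F₁ t (Real.cosh (dist (b t) (d t))) = hypAngle (a t) (b t) (d t) :=
    fun t => (hypAngle_eq_arccos (ha t).ne₁₂ (ha t).ne₃₁.symm).symm
  have e₂ : ∀ t, F₂ t (Real.cosh (dist (b t) (d t))) = hypAngle (c t) (b t) (d t) :=
    fun t => (hypAngle_eq_arccos (hcb t) (hcd t)).symm
  refine continuous_of_monotone_implicit (F := fun t v => F₁ t v + F₂ t v) (fun v => ?_)
    (fun t => (m₁ t).add (m₂ t)) (fun t v hv => ?_) ?_
  · refine Continuous.add ?_ ?_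
    · exact Real.continuous_arccos.comp
        (Continuous.div (by fun_prop) (by fun_prop) fun t => (hs₁ t).ne')
    · exact Real.continuous_arccos.comp
        (Continuous.div (by fun_prop) (by fun_prop) fun t => (hs₂ t).ne')
  -- Strictness comes from the angle at $a$, which lies strictly between $0$ and $\pi$; for the
  -- angle at $c$ monotonicity suffices.
  · have hne : F₁ t v ≠ F₁ t (Real.cosh (dist (b t) (d t))) := by
      refine arccos_ne_arccos ((ha t).hypAngle_pos.trans_eq (e₁ t).symm)
        ((e₁ t).trans_lt (ha t).hypAngle_lt_pi) fun h => hv ?_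
      have := (div_left_inj' (hs₁ t).ne').1 h
      linarith
    rcases hv.lt_or_gt with h | h
    · exact (add_lt_add_of_lt_of_le ((m₁ t h.le).lt_of_ne hne) (m₂ t h.le)).ne
    · exact (add_lt_add_of_lt_of_le ((m₁ t h.le).lt_of_ne hne.symm) (m₂ t h.le)).ne'
  · simpa only [e₁, e₂] using h

end Continuity

/-! ### The fan of triangles with apex $Q_0=Q_{4g}$. -/

namespace CanonicalPolygon

variable {g : ℕ}

/-- The vertex `Q_i`, with the index a natural number. -/
def vert (P : CanonicalPolygon g) (i : ℕ) : ℍ := P.vertex i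

theorem vert_last (P : CanonicalPolygon g) : P.vert (4 * g) = P.vert 0 := by
  simp only [vert, ZMod.natCast_self, Nat.cast_zero]

theorem sideLength_succ (P : CanonicalPolygon g) (j : ℕ) :
    P.sideLength (j + 1 : ℕ) = dist (P.vert j) (P.vert (j + 1)) := by
  simp [sideLength, polygonSideLength, vert]

theorem angle_succ (P : CanonicalPolygon g) (j : ℕ) :
    P.angle (j + 1 : ℕ) = hypAngle (P.vert (j + 1)) (P.vert j) (P.vert (j + 2)) := by
  simp [angle, polygonAngle, vert, add_assoc, one_add_one_eq_two]

theorem isRightOf_vert (P : CanonicalPolygon g) {i k : ℕ} (hi : i + 1 < 4 * g) (hk : k < 4 * g)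
    (h₁ : k ≠ i) (h₂ : k ≠ i + 1) : IsRightOf (P.vert i) (P.vert (i + 1)) (P.vert k) := by
  have h := P.convex (i + 1 : ℕ) k
  rw [show ((i + 1 : ℕ) : ZMod (4 * g)) - 1 = (i : ℕ) by simp] at h
  refine h ?_ ?_
  · rw [Ne, ZMod.natCast_eq_natCast_iff', Nat.mod_eq_of_lt hk, Nat.mod_eq_of_lt (by omega)]
    exact h₁
  · rw [Ne, ZMod.natCast_eq_natCast_iff', Nat.mod_eq_of_lt hk, Nat.mod_eq_of_lt hi]
    exact h₂

theorem isRightOf_fan (P : CanonicalPolygon g) {j : ℕ} (hj : j + 2 < 4 * g) :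
    IsRightOf (P.vert (j + 1)) (P.vert (j + 2)) (P.vert 0) :=
  P.isRightOf_vert hj (by omega) (by omega) (by omega)

theorem angle_eq_add (P : CanonicalPolygon g) {j : ℕ} (hj : j + 2 < 4 * g) :
    P.angle (j + 1 : ℕ) = hypAngle (P.vert (j + 1)) (P.vert j) (P.vert 0) +
      hypAngle (P.vert (j + 1)) (P.vert (j + 2)) (P.vert 0) := by
  rw [angle_succ]
  rcases j.eq_zero_or_pos with rfl | hpos
  -- At $Q_1$ there is nothing to split: $Q_j$ is the apex itself, and the first summand is zero.
  · rw [hypAngle_self (P.isRightOf_fan hj).ne₃₁.symm, hypAngle_comm]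
    simp only [zero_add]
  · have := hypAngle_add (P.isRightOf_fan hj)
      (P.isRightOf_vert (i := j) (k := 0) (by omega) (by omega) (by omega) (by omega)).rotate
      (P.isRightOf_vert (i := j) (k := j + 2) (by omega) (by omega) (by omega) (by omega)).rotate
    rw [hypAngle_comm, ← this, hypAngle_comm _ (P.vert j), add_comm]

theorem exists_eq_natCast_succ (hg : 0 < g) (i : ZMod (4 * g)) :
    ∃ j : ℕ, j < 4 * g ∧ i = (j + 1 : ℕ) := by
  have : NeZero (4 * g) := ⟨by omega⟩
  exact ⟨(i - 1).val, ZMod.val_lt _, by simp⟩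

section Continuity

variable {Y : Type*} [TopologicalSpace Y] {p : Y → CanonicalPolygon g}

/-- Side-angle-side step across one triangle of the fan; the enclosed angle is what the previous
triangle leaves of $\alpha_{j+1}$. -/
theorem continuous_fan_of_side {j : ℕ} (hj : j + 2 < 4 * g)
    (hα : Continuous fun y => (p y).angle (j + 1 : ℕ))
    (hs : Continuous fun y => dist ((p y).vert (j + 1)) ((p y).vert (j + 2)))
    (hD : Continuous fun y => dist ((p y).vert (j + 1)) ((p y).vert 0))
    (hψ : Continuous fun y => hypAngle ((p y).vert (j + 1)) ((p y).vert j) ((p y).vert 0)) :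
    (Continuous fun y => dist ((p y).vert (j + 2)) ((p y).vert 0)) ∧
    (Continuous fun y => hypAngle ((p y).vert (j + 2)) ((p y).vert (j + 1)) ((p y).vert 0)) := by
  have hω : Continuous fun y =>
      hypAngle ((p y).vert (j + 1)) ((p y).vert (j + 2)) ((p y).vert 0) :=
    (hα.sub hψ).congr fun y =>
      sub_eq_of_eq_add' ((p y).angle_eq_add hj)
  have hD' := continuous_dist_of_hypAngle hs hD hω
  refine ⟨hD', continuous_hypAngle_of_dist (fun y => ((p y).isRightOf_fan hj).ne₁₂.symm)
    (fun y => ((p y).isRightOf_fan hj).ne₂₃) ?_ hD' hD⟩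
  simpa only [dist_comm] using hs

/-- Angle-side-angle step: the outer side is not given, but the angle at the apex is. -/
theorem continuous_fan_of_angle {j : ℕ} (hj : j + 2 < 4 * g)
    (hα : Continuous fun y => (p y).angle (j + 1 : ℕ))
    (hβ : Continuous fun y => hypAngle ((p y).vert 0) ((p y).vert (j + 1)) ((p y).vert (j + 2)))
    (hD : Continuous fun y => dist ((p y).vert (j + 1)) ((p y).vert 0))
    (hψ : Continuous fun y => hypAngle ((p y).vert (j + 1)) ((p y).vert j) ((p y).vert 0)) :
    (Continuous fun y => dist ((p y).vert (j + 1)) ((p y).vert (j + 2))) ∧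
    (Continuous fun y => dist ((p y).vert (j + 2)) ((p y).vert 0)) ∧
    (Continuous fun y => hypAngle ((p y).vert (j + 2)) ((p y).vert (j + 1)) ((p y).vert 0)) := by
  have hω : Continuous fun y =>
      hypAngle ((p y).vert (j + 1)) ((p y).vert (j + 2)) ((p y).vert 0) :=
    (hα.sub hψ).congr fun y =>
      sub_eq_of_eq_add' ((p y).angle_eq_add hj)
  have hr := fun y => ((p y).isRightOf_fan hj)
  have hψ' := continuous_hypAngle_of_hypAngle (fun y => (hr y).ne₃₁) (fun y => (hr y).ne₁₂)
    (fun y => (hr y).ne₂₃) hβ hω (by simpa only [dist_comm] using hD)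
  refine ⟨?_, ?_, by simpa only [hypAngle_comm] using hψ'⟩
  · exact continuous_dist_of_hypAngles hr hω hψ' hβ
  · exact continuous_dist_of_hypAngles (fun y => (hr y).rotate) hψ' hβ hω

theorem continuous_fan_zero
    (hD : Continuous fun y => dist ((p y).vert 0) ((p y).vert 1)) (hg : 0 < g) :
    (Continuous fun y => dist ((p y).vert 1) ((p y).vert 0)) ∧
    (Continuous fun y => hypAngle ((p y).vert 1) ((p y).vert 0) ((p y).vert 0)) := by
  refine ⟨by simpa only [dist_comm] using hD, ?_⟩
  simp only [fun y => hypAngle_self ((p y).isRightOf_fan (j := 0) (by omega)).ne₃₁.symm]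
  exact continuous_const

theorem continuous_fan (hg : 0 < g) {N : ℕ} (hN : N + 1 < 4 * g)
    (hα : ∀ j < N, Continuous fun y => (p y).angle (j + 1 : ℕ))
    (hs : ∀ j < 4 * g, Continuous fun y => dist ((p y).vert j) ((p y).vert (j + 1))) (j : ℕ)
    (hj : j ≤ N) :
    (Continuous fun y => dist ((p y).vert (j + 1)) ((p y).vert 0)) ∧
    (Continuous fun y => hypAngle ((p y).vert (j + 1)) ((p y).vert j) ((p y).vert 0)) := by
  induction j with
  | zero => exact continuous_fan_zero (hs 0 (by omega)) hg
  | succ j ih =>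
    obtain ⟨h₁, h₂⟩ := ih (by omega)
    exact continuous_fan_of_side (by omega) (hα j (by omega)) (hs (j + 1) (by omega)) h₁ h₂

theorem continuous_hypAngle_zero {j : ℕ} (hj : j + 2 < 4 * g)
    (h₁ : Continuous fun y => dist ((p y).vert (j + 1)) ((p y).vert 0))
    (h₂ : Continuous fun y => dist ((p y).vert (j + 2)) ((p y).vert 0))
    (hs : Continuous fun y => dist ((p y).vert (j + 1)) ((p y).vert (j + 2))) :
    Continuous fun y => hypAngle ((p y).vert 0) ((p y).vert (j + 1)) ((p y).vert (j + 2)) := by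
  have hr := fun y => ((p y).isRightOf_fan hj)
  refine continuous_hypAngle_of_dist (fun y => (hr y).ne₃₁) (fun y => (hr y).ne₂₃.symm) ?_ ?_ hs
  · simpa only [dist_comm] using h₁
  · simpa only [dist_comm] using h₂

end Continuity

end CanonicalPolygon

/-! ### Linear relations between the interior angles. -/

theorem sum_Icc_two_mul {M : Type*} [AddCommMonoid M] (f : ℕ → M) (n : ℕ) :
    ∑ i ∈ Finset.Icc 1 (2 * n), f i = ∑ i ∈ Finset.Icc 1 n, (f (2 * i - 1) + f (2 * i)) := by
  induction n with
  | zero => simp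
  | succ n ih =>
    rw [show 2 * (n + 1) = 2 * n + 1 + 1 by ring, Finset.sum_Icc_succ_top (by omega),
      Finset.sum_Icc_succ_top (by omega), Finset.sum_Icc_succ_top (by omega), ih, add_assoc]
    rfl

theorem sum_Icc_add_sum_Icc {M : Type*} [AddCommMonoid M] (f : ℕ → M) (g : ℕ) :
    ∑ i ∈ Finset.Icc 1 g, f i + ∑ i ∈ Finset.Icc (g + 1) (2 * g), f i =
      ∑ i ∈ Finset.Icc 1 (2 * g), f i := by
  have := Finset.sum_Ioc_consecutive f (Nat.zero_le g) (show g ≤ 2 * g by omega)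
  simpa only [← Finset.Icc_add_one_left_eq_Ioc, zero_add] using this

namespace CanonicalPolygon

variable {g : ℕ}

/-- Condition (v) splits the total $2\pi$ of (ii) into two equal halves. -/
theorem half_angle_sum (P : CanonicalPolygon g) :
    ∑ i ∈ Finset.Icc 1 g, P.angle (2 * i : ℕ) +
      ∑ i ∈ Finset.Icc (g + 1) (2 * g), P.angle (2 * i - 1 : ℕ) = Real.pi := by
  have h₁ : ∑ i ∈ Finset.Icc 1 (2 * (2 * g)), P.angle i = 2 * Real.pi := by
    rw [show 2 * (2 * g) = 4 * g by ring]
    exact P.angle_sum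
  have h₂ := P.angle_alternating
  rw [sum_Icc_two_mul, ← sum_Icc_add_sum_Icc,
    Finset.sum_add_distrib, Finset.sum_add_distrib] at h₁
  have cast_odd : ∀ a b : ℕ, 1 ≤ a → ∑ i ∈ Finset.Icc a b, polygonAngle P.vertex (2 * i - 1) =
      ∑ i ∈ Finset.Icc a b, P.angle (2 * i - 1 : ℕ) := fun a b ha =>
    Finset.sum_congr rfl fun i hi => by
      rw [Finset.mem_Icc] at hi
      rw [Nat.cast_sub (by omega)]
      simp [angle]
  have cast_even : ∀ a b : ℕ, ∑ i ∈ Finset.Icc a b, polygonAngle P.vertex (2 * i) =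
      ∑ i ∈ Finset.Icc a b, P.angle (2 * i : ℕ) := fun a b =>
    Finset.sum_congr rfl fun i hi => by simp [angle]
  rw [cast_odd _ _ le_rfl, cast_odd _ _ (by omega), cast_even, cast_even] at h₂
  linarith

/-- The sum of the angles at `Q_{4g-3}` and `Q_{4g-1}` in terms of the preceding angles. -/
theorem angle_add_angle (hg : 3 ≤ g) (P : CanonicalPolygon g) :
    P.angle (4 * g - 3 : ℕ) + P.angle (4 * g - 1 : ℕ) = Real.pi -
      ∑ i ∈ Finset.Icc 1 g, P.angle (2 * i : ℕ) -
      ∑ i ∈ Finset.Icc (g + 1) (2 * g - 2), P.angle (2 * i - 1 : ℕ) := by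
  have h := P.half_angle_sum
  rw [show 2 * g = 2 * g - 2 + 1 + 1 by omega, Finset.sum_Icc_succ_top (by omega),
    Finset.sum_Icc_succ_top (by omega), show 2 * (2 * g - 2 + 1) - 1 = 4 * g - 3 by omega,
    show 2 * (2 * g - 2 + 1 + 1) - 1 = 4 * g - 1 by omega] at h
  linarith

theorem angle_add_sum (hg : 0 < g) (P : CanonicalPolygon g) :
    P.angle (4 * g : ℕ) = 2 * Real.pi - ∑ i ∈ Finset.Icc 1 (4 * g - 1), P.angle i := by
  have key : ∀ (f : ℕ → ℝ) (n : ℕ), 0 < n →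
      ∑ i ∈ Finset.Icc 1 n, f i = ∑ i ∈ Finset.Icc 1 (n - 1), f i + f n := fun f n hn => by
    obtain ⟨m, rfl⟩ := Nat.exists_eq_add_one.2 hn
    exact Finset.sum_Icc_succ_top (by omega) f
  rw [← P.angle_sum]
  exact eq_sub_of_add_eq' (key (fun i => P.angle i) (4 * g) (by omega)).symm

/-! ### Continuous dependence between $\theta$ and the sides and angles, in both directions. -/

section Continuity

variable {Y : Type*} [TopologicalSpace Y] {p : Y → CanonicalPolygon g}

theorem continuous_fan_of_sideLength_angle (hg : 0 < g)
    (hs : ∀ i, Continuous fun y => (p y).sideLength i)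
    (hα : ∀ i, Continuous fun y => (p y).angle i) {j : ℕ} (hj : j + 2 < 4 * g) :
    (Continuous fun y => dist ((p y).vert (j + 1)) ((p y).vert 0)) ∧
    (Continuous fun y => dist ((p y).vert (j + 2)) ((p y).vert 0)) ∧
    (Continuous fun y => hypAngle ((p y).vert 0) ((p y).vert (j + 1)) ((p y).vert (j + 2))) ∧
    (Continuous fun y => hypAngle ((p y).vert (j + 2)) ((p y).vert (j + 1)) ((p y).vert 0)) := by
  have hs' : ∀ j < 4 * g, Continuous fun y => dist ((p y).vert j) ((p y).vert (j + 1)) :=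
    fun j _ => by simpa only [sideLength_succ] using hs (j + 1 : ℕ)
  have h := continuous_fan hg (N := 4 * g - 2) (by omega) (fun j _ => hα _) hs'
  obtain ⟨h₁, -⟩ := h j (by omega)
  obtain ⟨h₂, h₃⟩ := h (j + 1) (by omega)
  exact ⟨h₁, h₂, continuous_hypAngle_zero hj h₁ h₂ (hs' _ (by omega)), h₃⟩

theorem beta_succ (P : CanonicalPolygon g) (j : ℕ) :
    P.beta (j + 1) = hypAngle (P.vert 0) (P.vert (j + 1)) (P.vert (j + 2)) := by
  rw [beta, show P.vertex (4 * g : ℕ) = P.vert 0 from P.vert_last]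
  simp [vert, add_assoc, one_add_one_eq_two]

theorem phiOne_eq (P : CanonicalPolygon g) :
    P.phiOne = hypAngle (P.vert 2) (P.vert 0) (P.vert 1) := by
  rw [phiOne, show P.vertex (4 * g : ℕ) = P.vert 0 from P.vert_last]
  simp [vert]

theorem continuous_angleParameters_comp (hg : 3 ≤ g)
    (hs : ∀ i, Continuous fun y => (p y).sideLength i)
    (hα : ∀ i, Continuous fun y => (p y).angle i) :
    Continuous fun y => (p y).angleParameters := by
  have h := fun {j} => continuous_fan_of_sideLength_angle (j := j) (by omega) hs hα
  refine continuous_pi fun k => ?_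
  have hk := k.isLt
  simp only [angleParameters]
  split_ifs with h₁ h₂
  · simp only [phiOne_eq, hypAngle_comm _ (vert _ 0)]
    exact (h (j := 0) (by omega)).2.2.2
  · exact hα _
  · obtain ⟨j, hj⟩ : ∃ j, k.val + 1 - (4 * g - 4) = j + 1 := ⟨k.val - (4 * g - 4), by omega⟩
    simp only [hj, beta_succ]
    exact (h (by omega)).2.2.1

theorem continuous_angle_of_angleParameters (hg : 3 ≤ g)
    (h : Continuous fun y => (p y).angleParameters) {i : ℕ} (hi : 0 < i) (hi' : i ≤ 4 * g - 4) :
    Continuous fun y => (p y).angle i := by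
  have key : ∀ i, 0 < i → i ≤ 4 * g - 4 → i ≠ 2 * g + 1 → Continuous fun y => (p y).angle i := by
    intro i hi hi' hne
    have := (continuous_apply (⟨i - 1, by omega⟩ : Fin (6 * g - 5))).comp h
    convert this using 2 with y
    simp only [Function.comp, angleParameters, Nat.sub_add_cancel hi]
    rw [if_neg hne, if_pos hi']
  -- The slot $2g+1$ holds $\phi_1$, so $\alpha_{2g+1}$ is recovered from (iv).
  rcases eq_or_ne i (2 * g + 1) with rfl | hne
  · have h₁ : ∀ y, (p y).angle (2 * g + 1 : ℕ) = (p y).angle (1 : ℕ) := fun y => by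
      have := (p y).angle_one
      simp only [angle]
      push_cast
      exact this.symm
    simp only [h₁]
    exact key 1 one_pos (by omega) (by omega)
  · exact key i hi hi' hne

theorem continuous_side_of_angleParameters (hg : 3 ≤ g)
    (h : Continuous fun y => (p y).angleParameters) {j : ℕ} (hj : j < 4 * g) :
    Continuous fun y => dist ((p y).vert j) ((p y).vert (j + 1)) := by
  have hα := fun {i} => continuous_angle_of_angleParameters (i := i) hg h
  have hβ : ∀ j < 2 * g - 1, Continuous fun y =>
      hypAngle ((p y).vert 0) ((p y).vert (j + 1)) ((p y).vert (j + 2)) := by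
    intro j hj
    have := (continuous_apply (⟨j + (4 * g - 4), by omega⟩ : Fin (6 * g - 5))).comp h
    convert this using 2 with y
    simp only [Function.comp, angleParameters]
    rw [if_neg (by omega), if_neg (by omega),
      show j + (4 * g - 4) + 1 - (4 * g - 4) = j + 1 by omega, beta_succ]
  have hφ : Continuous fun y => hypAngle ((p y).vert 2) ((p y).vert 0) ((p y).vert 1) := by
    have := (continuous_apply (⟨2 * g, by omega⟩ : Fin (6 * g - 5))).comp h
    convert this using 2 with y
    simp only [Function.comp, angleParameters]
    rw [if_pos trivial, phiOne_eq]
  -- All three angles $\beta_1,\alpha_1,\phi_1$ of the first triangle are parameters, and they fix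
  -- its size.
  have hD : Continuous fun y => dist ((p y).vert 0) ((p y).vert 1) := by
    refine continuous_dist_of_hypAngles
      (fun y => ((p y).isRightOf_fan (j := 0) (by omega)).rotate.rotate) (hβ 0 (by omega)) ?_ hφ
    refine (hα one_pos (by omega)).congr fun y => ?_
    exact ((p y).angle_succ 0).trans (hypAngle_comm _ _ _)
  have hfan : ∀ j < 2 * g, (Continuous fun y => dist ((p y).vert j) ((p y).vert (j + 1))) ∧
      (Continuous fun y => dist ((p y).vert (j + 1)) ((p y).vert 0)) ∧
      (Continuous fun y => hypAngle ((p y).vert (j + 1)) ((p y).vert j) ((p y).vert 0)) := by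
    intro j hj
    induction j with
    | zero => exact ⟨hD, continuous_fan_zero hD (by omega)⟩
    | succ j ih =>
      obtain ⟨-, h₁, h₂⟩ := ih (by omega)
      exact continuous_fan_of_angle (by omega) (hα (by omega) (by omega)) (hβ j (by omega)) h₁ h₂
  rcases lt_or_ge j (2 * g) with hlt | hge
  · exact (hfan j hlt).1
  · obtain ⟨k, rfl⟩ := Nat.exists_eq_add_of_le' hge
    have hopp : ∀ y, dist ((p y).vert (k + 2 * g)) ((p y).vert (k + 2 * g + 1)) =
        dist ((p y).vert k) ((p y).vert (k + 1)) := fun y => by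
      rw [← sideLength_succ, ← sideLength_succ]
      have := (p y).opposite_sides (k + 1 : ℕ)
      simp only [sideLength]
      rw [this]
      congr 1
      push_cast
      ring
    simp only [hopp]
    exact (hfan k (by omega)).1

theorem continuous_angle_of_angleParameters' (hg : 3 ≤ g)
    (h : Continuous fun y => (p y).angleParameters) {i : ℕ} (hi : 0 < i) (hi' : i ≤ 4 * g) :
    Continuous fun y => (p y).angle i := by
  have hα := fun {i} => continuous_angle_of_angleParameters (i := i) hg h
  have hs := fun {i} => continuous_side_of_angleParameters (j := i) hg h
  have hs' : ∀ {j}, j < 4 * g → Continuous fun y => dist ((p y).vert (j + 1)) ((p y).vert j) :=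
    fun hj => by simpa only [dist_comm] using hs hj
  -- The angles up to $\alpha_m$ are known; the vertices $Q_{m+1},\dots,Q_{m+4}=Q_0$ span the
  -- remaining quadrilateral.
  obtain ⟨m, hm⟩ : ∃ m, 4 * g = m + 4 := ⟨4 * g - 4, by omega⟩
  obtain ⟨hD, hψ⟩ := continuous_fan (by omega) (N := m) (by omega)
    (fun j _ => hα (by omega) (by omega)) (fun j hj => hs hj) m le_rfl
  have hlast : ∀ P : CanonicalPolygon g, P.vert (m + 4) = P.vert 0 := fun P => hm ▸ P.vert_last
  have hr₁ := fun y => ((p y).isRightOf_fan (j := m) (by omega))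
  have hr₂ := fun y => ((p y).isRightOf_fan (j := m + 1) (by omega))
  have hDlast : Continuous fun y => dist ((p y).vert (m + 3)) ((p y).vert 0) := by
    simpa only [hlast] using hs (i := m + 3) (by omega)
  have hsum : Continuous fun y => (p y).angle (m + 1 : ℕ) + (p y).angle (m + 3 : ℕ) := by
    have := fun y => (p y).angle_add_angle hg
    rw [show 4 * g - 3 = m + 1 by omega, show 4 * g - 1 = m + 3 by omega] at this
    simp only [this]
    refine (continuous_const.sub (continuous_finsetSum _ fun i hi => ?_)).sub
      (continuous_finsetSum _ fun i hi => ?_)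
    all_goals
      rw [Finset.mem_Icc] at hi
      exact hα (by omega) (by omega)
  have hα₃ : ∀ y, (p y).angle (m + 3 : ℕ) =
      hypAngle ((p y).vert (m + 3)) ((p y).vert (m + 2)) ((p y).vert 0) := fun y => by
    rw [angle_succ, hlast]
  have hdiag : Continuous fun y => dist ((p y).vert (m + 2)) ((p y).vert 0) := by
    refine continuous_dist_diagonal hr₁ (c := fun y => (p y).vert (m + 3))
      (fun y => (hr₂ y).ne₁₂.symm) (fun y => (hr₂ y).ne₂₃) (hs (by omega)) hD (hs' (by omega))
      hDlast ?_
    -- Removing from $\alpha_{m+1}$ the part outside the quadrilateral leaves the two angles facing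
    -- the diagonal.
    refine (hsum.sub hψ).congr fun y => ?_
    simp only [Pi.sub_apply]
    rw [(p y).angle_eq_add (by omega), hα₃]
    ring
  have h₃ : Continuous fun y => (p y).angle (m + 3 : ℕ) := by
    simp only [hα₃]
    exact continuous_hypAngle_of_dist (fun y => (hr₂ y).ne₁₂.symm) (fun y => (hr₂ y).ne₂₃)
      (hs' (by omega)) hDlast hdiag
  have h₁ : Continuous fun y => (p y).angle (m + 1 : ℕ) :=
    (hsum.sub h₃).congr fun y => by simp
  have h₂ : Continuous fun y => (p y).angle (m + 2 : ℕ) := by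
    simp only [fun y => (p y).angle_eq_add (j := m + 1) (by omega)]
    refine Continuous.add ?_ ?_
    · exact continuous_hypAngle_of_dist (fun y => (hr₁ y).ne₁₂.symm) (fun y => (hr₁ y).ne₂₃)
        (hs' (by omega)) hdiag hD
    · exact continuous_hypAngle_of_dist (fun y => (hr₂ y).ne₁₂) (fun y => (hr₂ y).ne₃₁.symm)
        (hs (by omega)) hdiag hDlast
  have hlt : ∀ i, 0 < i → i < m + 4 → Continuous fun y => (p y).angle i := by
    intro i hi hi'
    rcases le_or_gt i (4 * g - 4) with hle | hgt
    · exact hα hi hle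
    · obtain rfl | rfl | rfl : i = m + 1 ∨ i = m + 2 ∨ i = m + 3 := by omega
      exacts [h₁, h₂, h₃]
  rcases hi'.lt_or_eq with hlt' | rfl
  · exact hlt i hi (by omega)
  · simp only [angle_add_sum (show 0 < g by omega)]
    refine continuous_const.sub (continuous_finsetSum _ fun i hi => ?_)
    rw [Finset.mem_Icc] at hi
    exact hlt i (by omega) (by omega)

theorem continuous_sideLength_angle_of_angleParameters (hg : 3 ≤ g)
    (h : Continuous fun y => (p y).angleParameters) (i : ZMod (4 * g)) :
    (Continuous fun y => (p y).sideLength i) ∧ Continuous fun y => (p y).angle i := by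
  obtain ⟨j, hj, rfl⟩ := exists_eq_natCast_succ (by omega) i
  simp only [sideLength_succ]
  exact ⟨continuous_side_of_angleParameters hg h hj,
    continuous_angle_of_angleParameters' hg h (by omega) (by omega)⟩

end Continuity

theorem isInducing_angleParameters (hg : 3 ≤ g) :
    Topology.IsInducing (angleParameters : CanonicalPolygon g → _) := by
  refine ⟨le_antisymm ?_ ?_⟩
  · rw [← continuous_iff_le_induced]
    have h : Continuous fun P : CanonicalPolygon g => (P.sideLength, P.angle) :=
      continuous_induced_dom
    exact continuous_angleParameters_comp (p := id) hg
      (fun i => (continuous_apply i).comp h.fst) (fun i => (continuous_apply i).comp h.snd)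
  · refine continuous_iff_le_induced.1 ?_
    -- The reconstruction is applied to the identity family over the polygons with the topology
    -- induced by $\theta$.
    let _ : TopologicalSpace (CanonicalPolygon g) := .induced angleParameters inferInstance
    have h := continuous_sideLength_angle_of_angleParameters (p := id) hg
      (continuous_induced_dom (f := (angleParameters : CanonicalPolygon g → _)))
    exact (continuous_pi fun i => (h i).1).prodMk (continuous_pi fun i => (h i).2)

end CanonicalPolygon

/-! ### Equivalence of polygons is topological inseparability. -/

namespace CanonicalPolygon

variable {g : ℕ}

theorem isRightOf_vertex (hg : 0 < g) (P : CanonicalPolygon g) (i : ZMod (4 * g)) :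
    IsRightOf (P.vertex (i - 1)) (P.vertex i) (P.vertex (i + 1)) := by
  have h : ∀ n : ℕ, 0 < n → n < 4 * g → (n : ZMod (4 * g)) ≠ 0 := fun n hn hn' h =>
    absurd (Nat.le_of_dvd hn ((ZMod.natCast_eq_zero_iff _ _).1 h)) (by omega)
  refine P.convex i (i + 1) (fun h' => h 2 two_pos (by omega) ?_)
    fun h' => h 1 one_pos (by omega) ?_
  · push_cast
    linear_combination h'
  · push_cast
    linear_combination h'

theorem map_vertex_of_image_side (hg : 0 < g) {P P' : CanonicalPolygon g} {e : ℍ ≃ᵢ ℍ}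
    (he : ∀ i, e '' P.side i = P'.side i) (i : ZMod (4 * g)) :
    e (P.vertex i) = P'.vertex i := by
  have key : ∀ i, e (P.vertex (i - 1)) = P'.vertex (i - 1) ∧ e (P.vertex i) = P'.vertex i ∨
      e (P.vertex (i - 1)) = P'.vertex i ∧ e (P.vertex i) = P'.vertex (i - 1) := fun i =>
    endpoints_of_hypSegment_eq (e.injective.ne (P.isRightOf_vertex hg i).ne₁₂)
      ((image_hypSegment e _ _).symm.trans (he i))
  rcases key i with ⟨-, h⟩ | ⟨-, h⟩
  · exact h
  -- If $e$ reversed $a_i$, then $Q_i$ would go to $Q'_{i-1}$, which is not an endpoint of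
  -- $a'_{i+1}$.
  · have h' := key (i + 1)
    rw [add_sub_cancel_right] at h'
    rcases h' with ⟨h', -⟩ | ⟨h', -⟩
    · exact h'
    · exact absurd (h'.symm.trans h) (P'.isRightOf_vertex hg i).ne₃₁

theorem inseparable_iff {P P' : CanonicalPolygon g} :
    Inseparable P P' ↔ P.sideLength = P'.sideLength ∧ P.angle = P'.angle := by
  have h : Topology.IsInducing fun P : CanonicalPolygon g => (P.sideLength, P.angle) := ⟨rfl⟩
  rw [← h.inseparable_iff, inseparable_eq_eq, Prod.mk.injEq]

theorem inseparable_of_equiv (hg : 0 < g) {P P' : CanonicalPolygon g} (h : P ≈ P') :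
    Inseparable P P' := by
  obtain ⟨e, he⟩ := h
  have hv := map_vertex_of_image_side hg he
  refine inseparable_iff.2 ⟨funext fun i => ?_, funext fun i => ?_⟩
  · simp only [sideLength, polygonSideLength, ← hv, e.isometry.dist_eq]
  · have hr := P.isRightOf_vertex hg i
    simp only [angle, polygonAngle, ← hv, hypAngle_map_isometry e.isometry hr.ne₁₂.symm hr.ne₂₃]

/-- Continuous real functions agree at inseparable points, so the diagonals from $Q_0$ and the
angles between them agree. These are polar coordinates of the vertices about $Q_0$, up to one
rotation. -/
theorem equiv_of_inseparable (hg : 0 < g) {P P' : CanonicalPolygon g} (h : Inseparable P P') :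
    P ≈ P' := by
  have hcont : Continuous fun P : CanonicalPolygon g => (P.sideLength, P.angle) :=
    continuous_induced_dom
  have hfan := fun {j : ℕ} (hj : j + 2 < 4 * g) => continuous_fan_of_sideLength_angle (p := id)
    hg (fun i => (continuous_apply i).comp hcont.fst) (fun i => (continuous_apply i).comp hcont.snd)
    hj
  have hr := fun (P : CanonicalPolygon g) {j : ℕ} (hj : j + 2 < 4 * g) =>
    (P.isRightOf_fan hj).rotate.rotate
  have hnorm : ∀ j, j + 1 < 4 * g → ‖hypDir (P.vert 0) (P.vert (j + 1))‖ =
      ‖hypDir (P'.vert 0) (P'.vert (j + 1))‖ := by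
    intro j hj
    have : dist (P.vert (j + 1)) (P.vert 0) = dist (P'.vert (j + 1)) (P'.vert 0) := by
      rcases lt_or_ge (j + 2) (4 * g) with hlt | hge
      · exact (h.map (hfan hlt).1).eq
      · obtain ⟨k, rfl⟩ : ∃ k, j = k + 1 := Nat.exists_eq_add_one.2 (by omega)
        exact (h.map (hfan (j := k) (by omega)).2.1).eq
    rw [norm_hypDir, norm_hypDir, dist_comm, this, dist_comm]
  have hne : ∀ (P : CanonicalPolygon g) {j : ℕ}, j + 2 < 4 * g →
      hypDir (P.vert 0) (P.vert (j + 1)) ≠ 0 := fun P j hj => mt hypDir_eq_zero.1 (hr P hj).ne₁₂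
  have hratio : ∀ j, j + 2 < 4 * g →
      hypDir (P.vert 0) (P.vert (j + 2)) / hypDir (P.vert 0) (P.vert (j + 1)) =
      hypDir (P'.vert 0) (P'.vert (j + 2)) / hypDir (P'.vert 0) (P'.vert (j + 1)) := by
    intro j hj
    -- The clockwise order fixes the sign of the argument, so the unsigned angle determines the
    -- quotient.
    refine Complex.ext_norm_arg ?_ (neg_injective ?_)
    · rw [norm_div, norm_div, hnorm j (by omega),
        show ‖hypDir (P.vert 0) (P.vert (j + 2))‖ = _ from hnorm (j + 1) hj]
    · rw [← (hr P hj).hypAngle_eq, ← (hr P' hj).hypAngle_eq]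
      exact (h.map (hfan hj).2.2.1).eq
  have hc : ‖hypDir (P'.vert 0) (P'.vert 1) / hypDir (P.vert 0) (P.vert 1)‖ = 1 := by
    rw [norm_div, hnorm 0 (by omega), div_self]
    exact norm_ne_zero_iff.2 (hne P' (j := 0) (by omega))
  obtain ⟨e, he₀, he⟩ := exists_isometry_hypDir (P.vert 0) (P'.vert 0) hc
  have hdir : ∀ j, j + 1 < 4 * g → hypDir (P'.vert 0) (P'.vert (j + 1)) =
      hypDir (P'.vert 0) (P'.vert 1) / hypDir (P.vert 0) (P.vert 1) *
        hypDir (P.vert 0) (P.vert (j + 1)) := by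
    intro j hj
    induction j with
    | zero => exact (div_mul_cancel₀ _ (hne P (j := 0) (by omega))).symm
    | succ j ih =>
      have h₁ := hratio j hj
      rw [div_eq_div_iff (hne P hj) (hne P' hj), ih (by omega)] at h₁
      refine mul_right_cancel₀ (hne P hj) (h₁.symm.trans ?_)
      ring
  have hvert : ∀ j < 4 * g, e (P.vert j) = P'.vert j := by
    rintro (_ | j) hj
    · exact he₀
    · exact hypDir_injective (P'.vert 0) ((he _).trans (hdir j hj).symm)
  have hvertex : ∀ i, e (P.vertex i) = P'.vertex i := by
    intro i
    have : NeZero (4 * g) := ⟨by omega⟩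
    simpa [vert] using hvert i.val (ZMod.val_lt i)
  exact ⟨e, fun i => by rw [side, side, image_hypSegment, hvertex, hvertex]⟩

end CanonicalPolygon

/-! ### Passage to the quotient. -/

theorem theorem1 (g : ℕ) (hg : 3 ≤ g) :
    ∃ Θ : TeichmullerSpace g → (Fin (6 * g - 5) → ℝ),
      (∀ P : CanonicalPolygon g, Θ (Quotient.mk (CanonicalPolygon.setoid g) P) =
        P.angleParameters) ∧
      Topology.IsEmbedding Θ := by
  have hind := CanonicalPolygon.isInducing_angleParameters hg
  have hiff : ∀ P P' : CanonicalPolygon g, P ≈ P' ↔ P.angleParameters = P'.angleParameters :=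
    fun P P' => by
      -- In the Hausdorff target equality is inseparability, which an inducing map reflects.
      rw [← inseparable_eq_eq, hind.inseparable_iff]
      exact ⟨CanonicalPolygon.inseparable_of_equiv (by omega),
        CanonicalPolygon.equiv_of_inseparable (by omega)⟩
  refine ⟨Quotient.lift CanonicalPolygon.angleParameters fun P P' h => (hiff P P').1 h,
    fun P => rfl, ⟨⟨le_antisymm ?_ ?_⟩, ?_⟩⟩
  · exact continuous_iff_le_induced.1 (hind.continuous.quotient_lift _)
  · intro U hU
    obtain ⟨V, hV, hVU⟩ := hind.isOpen_iff.1 (hU.preimage continuous_quotient_mk')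
    refine ⟨V, hV, Set.ext fun x => ?_⟩
    induction x using Quotient.inductionOn with | _ P
    exact Set.ext_iff.1 hVU P
  · intro x y
    induction x, y using Quotient.inductionOn₂ with | _ P P'
    exact fun h => Quotient.sound ((hiff P P').2 h)
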